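/- Work over an algebraically closed field $K$ of characteristic zero. Let $n\ge 1$, $r_1,\dots,r_n\ge 1$, $d_1,\dots,d_n\ge 1$, $d_{n+1}\ge 2$ be integers, and set $$N=\prod_{i=1}^n\binom{r_i+d_i}{r_i},\qquad R=r_1+\dots+r_n,\qquad Y=\mathbb P^{r_1}\times\dots\times\mathbb P^{r_n},\qquad X=Y\times\mathbb P^1 .$$ Let $h,l$ be integers with $$0\le h\le\left\lfloor\frac{N}{R+1}\right\rfloor,\qquad 0\le l\le\left\lfloor\frac{N(d_{n+1}+1)}{R+2}\right\rfloor-\left\lfloor\frac{N}{R+1}\right\rfloor .$$ Here $\dim|\mathcal O(\underline a)(-\sum 2z_k)|$ denotes the dimension of the vector space of multihomogeneous forms of multidegree $\underline a$ vanishing to order at least two at every $z_k$, and a property holds for general points of a variety if it holds on a nonempty Zariski open subset of the irreducible variety parametrizing the tuples of points in question. Let $D\subset X$ be a divisor of type $(0,\dots,0,1)$, identified with $Y$ by the projection $X\to Y$. Assume that for $l$ general points $p_1,\dots,p_l$ of $X$ and $h$ general points $q_1,\dots,q_h$ of $D$ $$\dim\Big|\mathcal O_X(d_1,\dots,d_n,d_{n+1}-1)\Big(-\sum_{i=1}^l2p_i\Big)\Big|=N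 d_{n+1}-(R+2)l,$$ $$\dim\Big|\mathcal O_{Y}(d_1,\dots,d_n)\Big(-\sum_{j=1}^h2q_j\Big)\Big|=N-(R+1)h,$$ $$\dim\Big|\mathcal O_X(d_1,\dots,d_n,d_{n+1}-2)\Big(-\sum_{i=1}^l2p_i\Big)\Big|\le N d_{n+1}-(R+2)l-h .$$ Then for general $(p_1,\dots,p_l,q_1,\dots,q_h)\in X^l\times D^h$ $$\dim\Big|\mathcal O_X(d_1,\dots,d_n,d_{n+1})\Big(-\sum_{i=1}^l2p_i-\sum_{j=1}^h2q_j\Big)\Big|=N(d_{n+1}+1)-(R+2)(l+h).$$ -/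

import Mathlib

/-! Multiprojective spaces `ℙ^{r_i}` (product over `i : ι`), their multihomogeneous forms,
linear systems with assigned double points, and general tuples of points. -/

/-- The (closed points of the) product over `i` of the projective spaces `ℙ^{r i}` over `K`. -/
abbrev MultiProj (K : Type*) [Field K] {ι : Type*} (r : ι → ℕ) :=
  ∀ i, Projectivization K (Fin (r i + 1) → K)

/-- The Cox ring of `∏ ℙ^{r i}`: polynomials in one block of `r i + 1` variables for each `i`. -/
abbrev CoxRing (K : Type*) [Field K] {ι : Type*} (r : ι → ℕ) :=
  MvPolynomial (Σ i, Fin (r i + 1)) K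

namespace MultiProj

variable {K : Type*} [Field K] {ι : Type*} {r : ι → ℕ}

/-- Homogeneous coordinates of a point. A multihomogeneous form is only multiplied by a nonzero
constant when other coordinates are chosen, and likewise each of its partial derivatives, so the
vanishing conditions below do not depend on this choice. -/
noncomputable def coords (x : MultiProj K r) : (Σ i, Fin (r i + 1)) → K :=
  fun a => (x a.1).rep a.2

/-- `H⁰(∏ ℙ^{r i}, 𝒪(d))`: the polynomials that are homogeneous of degree `d i` in the `i`-th
block of variables, for every `i`. -/
noncomputable def sections (K : Type*) [Field K] {ι : Type*} [DecidableEq ι]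
    (r : ι → ℕ) (d : ι → ℕ) : Submodule K (CoxRing K r) :=
  MvPolynomial.weightedHomogeneousSubmodule K
    (fun a : Σ i, Fin (r i + 1) => (Pi.single a.1 1 : ι → ℕ)) d

/-- The form `f` vanishes at `x`. -/
def VanishesAt (f : CoxRing K r) (x : MultiProj K r) : Prop :=
  MvPolynomial.eval x.coords f = 0

/-- The form `f` vanishes to order at least two at `x`, i.e. on the double point `2x`. -/
def VanishesDoublyAt (f : CoxRing K r) (x : MultiProj K r) : Prop :=
  VanishesAt f x ∧ ∀ a, VanishesAt (MvPolynomial.pderiv a f) x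

/-- The vector space of sections of `𝒪(d)(-∑ 2 z_a)`. -/
noncomputable def doublePointSystem [DecidableEq ι] (d : ι → ℕ) {τ : Type*}
    (z : τ → MultiProj K r) : Submodule K (CoxRing K r) where
  carrier := {f | f ∈ sections K r d ∧ ∀ a, VanishesDoublyAt f (z a)}
  add_mem' := by
    rintro f g ⟨hf, hf'⟩ ⟨hg, hg'⟩
    refine ⟨Submodule.add_mem _ hf hg, fun a => ⟨?_, fun b => ?_⟩⟩
    · simpa [VanishesAt] using by
        rw [(hf' a).1, (hg' a).1, add_zero]
    · simpa [VanishesAt] using by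
        rw [(hf' a).2 b, (hg' a).2 b, add_zero]
  zero_mem' := ⟨Submodule.zero_mem _, fun a => by simp [VanishesDoublyAt, VanishesAt]⟩
  smul_mem' := by
    rintro c f ⟨hf, hf'⟩
    refine ⟨Submodule.smul_mem _ c hf, fun a => ⟨?_, fun b => ?_⟩⟩
    · have := (hf' a).1
      simp only [VanishesAt] at this
      simp [VanishesAt, this]
    · have := (hf' a).2 b
      simp only [VanishesAt] at this
      simp [VanishesAt, this]

/-- The dimension of the linear system `|𝒪(d)(-∑ 2 z_a)|`, counted as the dimension of the vector
space of its sections. -/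
noncomputable def dimSystem [DecidableEq ι] (d : ι → ℕ) {τ : Type*}
    (z : τ → MultiProj K r) : ℕ :=
  Module.finrank K (doublePointSystem d z)

/-- Zariski open subsets of `∏ ℙ^{r i}`: the complements of common zero sets of families of
multihomogeneous forms. -/
def IsZariskiOpen [DecidableEq ι] (U : Set (MultiProj K r)) : Prop :=
  ∃ A : Set (CoxRing K r), (∀ F ∈ A, ∃ d, F ∈ sections K r d) ∧
    U = {x | ∃ F ∈ A, ¬ VanishesAt F x}

/-- A tuple of points of `∏ ℙ^{r i}`, regarded as one point of a power of `∏ ℙ^{r i}`, which is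
again a multiprojective space. -/
def ofTuple {τ : Type*} (z : τ → MultiProj K r) : MultiProj K (fun b : τ × ι => r b.2) :=
  fun b => z b.1 b.2

/-- `P` holds for the general tuple belonging to `S`: it holds on a nonempty relatively Zariski
open subset of `S` (used for irreducible `S`). -/
def ForGeneralTuple [DecidableEq ι] {τ : Type*} [DecidableEq τ]
    (S : Set (τ → MultiProj K r)) (P : (τ → MultiProj K r) → Prop) : Prop :=
  ∃ U : Set (MultiProj K (fun b : τ × ι => r b.2)), IsZariskiOpen U ∧
    (∃ z ∈ S, ofTuple z ∈ U) ∧ ∀ z ∈ S, ofTuple z ∈ U → P z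

/-- Adjoin an entry `a`, at the new index `none`, to a family of natural numbers. In this way
`∏ ℙ^{r i} × ℙ^1` is `MultiProj K (adjoin r 1)`, and `adjoin d e` is the multidegree with the
entry `e` on the last factor. -/
def adjoin {ι : Type*} (r : ι → ℕ) (a : ℕ) : Option ι → ℕ
  | none => a
  | some i => r i

/-- The projection `∏ ℙ^{r i} × ℙ^a → ∏ ℙ^{r i}`. -/
def forgetLast {a : ℕ} (x : MultiProj K (adjoin r a)) : MultiProj K r :=
  fun i => x (some i)

/-- The support of the divisor of zeros of the form `s`. -/
def zeroDivisor (s : CoxRing K r) : Set (MultiProj K r) :=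
  {x | VanishesAt s x}

end MultiProj

/-! This is the Horace method: specialise `h` of the double points to the divisor `D = {s = 0}` and
compare with the trace on `D` and the residual. A double point imposes at most one condition more
than the dimension of the ambient variety, so the expected dimension is a lower bound for every
tuple (`finrank_sections_le`). The dimension is upper semicontinuous (`exists_form_dimSystem_le`),
so the upper bound is needed for a single tuple only.

Take `p` general and off `D`, and `q` general on `D`. Restriction to `D ≅ Y` sends the system into
the trace system, with double points at `q`. Its kernel consists of the forms `s * g`, where `g` has
degree one less on `ℙ^1`, is double at `p` and vanishes simply at `q`. This gives Castelnuovo's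
inequality (`dimSystem_sumElim_le`).

It remains to see that `q` imposes `h` conditions on the residual system `V` of forms double at `p`.
General points of `D` do so as soon as the restriction of `V` to `D` has rank at least `h`
(`exists_polynomial_independent`). The kernel of that restriction is `s` times the second residual
system, whose dimension is at most `dim V - h` by the third assumption. With `N`, `R` as in the
theorem and `a` the degree on `ℙ^1`, the bounds add up to `(N a - (R+2) l - h) + (N - (R+1) h) = N
(a+1) - (R+2) (l+h)`. -/

/-! ### Linear algebra: rank of a family of functionals through minors. -/

open Module in
/-- If the common kernel of a family of functionals has codimension at least `k`, then some
`k × k` minor of the family does not vanish. -/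
theorem Module.Dual.exists_det_ne_zero {K M κ : Type*} [Field K] [AddCommGroup M] [Module K M]
    [FiniteDimensional K M] (φ : κ → Dual K M) (W : Submodule K M)
    (hW : ∀ x, (∀ c, φ c x = 0) → x ∈ W) (k : ℕ) (hk : finrank K W + k ≤ finrank K M) :
    ∃ (c : Fin k → κ) (f : Fin k → M), (Matrix.of fun i j => φ (c i) (f j)).det ≠ 0 := by
  set S := Submodule.span K (Set.range φ) with hS
  have h1 : S.dualCoannihilator ≤ W := by
    intro x hx
    refine hW x fun c => ?_
    rw [Submodule.mem_dualCoannihilator] at hx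
    exact hx _ (Submodule.subset_span ⟨c, rfl⟩)
  have h2 := Subspace.finrank_add_finrank_dualCoannihilator_eq S
  have h3 := Submodule.finrank_mono h1
  have hkS : k ≤ finrank K S := by omega
  obtain ⟨g, hg, -, hli⟩ := Submodule.exists_fun_fin_finrank_span_eq K (Set.range φ)
  choose c hc using hg
  set g' : Fin k → Dual K M := fun i => g (Fin.castLE hkS i) with hg'
  have hli' : LinearIndependent K g' := hli.comp _ (Fin.castLE_injective hkS)
  have hsurj : Function.Surjective (LinearMap.pi g') := by
    rw [← LinearMap.range_eq_top]
    apply Submodule.eq_top_of_finrank_eq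
    have hker : LinearMap.ker (LinearMap.pi g') =
        (Submodule.span K (Set.range g')).dualCoannihilator := by
      ext x
      rw [← SetLike.mem_coe, ← SetLike.mem_coe, Submodule.coe_dualCoannihilator_span]
      simp [funext_iff]
    have h4 := LinearMap.finrank_range_add_finrank_ker (LinearMap.pi g')
    have h5 := Subspace.finrank_add_finrank_dualCoannihilator_eq
      (Submodule.span K (Set.range g'))
    rw [hker] at h4
    have h6 := finrank_span_eq_card hli'
    simp only [Fintype.card_fin] at h6
    simp only [finrank_fin_fun]
    omega
  -- Preimages of the standard basis vectors turn the minor into the identity matrix.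
  choose f hf using fun j : Fin k => hsurj (Pi.single j 1)
  refine ⟨fun i => c (Fin.castLE hkS i), f, ?_⟩
  have : (Matrix.of fun i j => φ (c (Fin.castLE hkS i)) (f j)) = 1 := by
    ext i j
    have := congrFun (hf j) i
    simp only [LinearMap.pi_apply, hg', ← hc] at this
    simp [this, Matrix.one_apply, Pi.single_apply]
  rw [this]
  simp

open Module in
/-- A nonvanishing `k × k` minor bounds the codimension of the common kernel from below. -/
theorem Module.Dual.finrank_add_le_of_det_ne_zero {K M : Type*} [Field K] [AddCommGroup M]
    [Module K M] [FiniteDimensional K M] {k : ℕ} (φ : Fin k → Dual K M) (f : Fin k → M)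
    (hdet : (Matrix.of fun i j => φ i (f j)).det ≠ 0)
    (W : Submodule K M) (hW : ∀ x ∈ W, ∀ i, φ i x = 0) :
    finrank K W + k ≤ finrank K M := by
  have hsurj : Function.Surjective (LinearMap.pi φ) := by
    intro y
    have hu : IsUnit (Matrix.of fun i j => φ i (f j)) := by
      rw [Matrix.isUnit_iff_isUnit_det]
      exact isUnit_iff_ne_zero.2 hdet
    obtain ⟨x, hx⟩ := Matrix.mulVec_surjective_iff_isUnit.2 hu y
    refine ⟨∑ j, x j • f j, ?_⟩
    rw [← hx]
    ext i
    simp [Matrix.mulVec, dotProduct, mul_comm]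
  have h4 := LinearMap.finrank_range_add_finrank_ker (LinearMap.pi φ)
  rw [LinearMap.range_eq_top.2 hsurj, finrank_top, finrank_fin_fun] at h4
  have : W ≤ LinearMap.ker (LinearMap.pi φ) := by
    intro x hx
    simp [funext_iff, hW x hx]
  have := Submodule.finrank_mono this
  omega

/-- A nonzero polynomial over an infinite field is nonzero at some point off all the
coordinate hyperplanes. -/
theorem MvPolynomial.exists_eval_ne_zero {K σ : Type*} [Field K] [Infinite K]
    {F : MvPolynomial σ K} (hF : F ≠ 0) : ∃ v : σ → K, (∀ a, v a ≠ 0) ∧ eval v F ≠ 0 := by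
  by_contra! hcon
  refine hF (funext_set (fun _ => {0}ᶜ) (fun _ => (Set.finite_singleton 0).infinite_compl) ?_)
  intro x hx
  rw [map_zero]
  exact hcon x fun a => hx a (Set.mem_univ a)

/-! ### Homogeneous coordinates and spaces of multihomogeneous forms. -/

namespace MultiProj

open MvPolynomial

variable {K : Type*} [Field K] {ι : Type*} {r : ι → ℕ}

/-- `v` is a vector of homogeneous coordinates of `x`. -/
def Represents (v : (Σ i, Fin (r i + 1)) → K) (x : MultiProj K r) : Prop :=
  ∃ c : ι → K, (∀ i, c i ≠ 0) ∧ x.coords = fun a => c a.1 * v a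

/-- The point with given homogeneous coordinates. -/
noncomputable def ofVec (v : (Σ i, Fin (r i + 1)) → K) (hv : ∀ i, ∃ j, v ⟨i, j⟩ ≠ 0) :
    MultiProj K r :=
  fun i => Projectivization.mk K (fun j => v ⟨i, j⟩) fun h =>
    (hv i).elim fun j hj => hj (congrFun h j)

theorem represents_ofVec (v : (Σ i, Fin (r i + 1)) → K) (hv : ∀ i, ∃ j, v ⟨i, j⟩ ≠ 0) :
    Represents v (ofVec v hv) := by
  choose c hc using fun i => Projectivization.exists_smul_eq_mk_rep K (fun j => v ⟨i, j⟩)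
    (fun h => (hv i).elim fun j hj => hj (congrFun h j))
  refine ⟨fun i => c i, fun i => (c i).ne_zero, ?_⟩
  ext ⟨i, j⟩
  exact (congrFun (hc i) j).symm

theorem coords_ne_zero (x : MultiProj K r) (i : ι) : ∃ j, x.coords ⟨i, j⟩ ≠ 0 := by
  by_contra! h
  exact (x i).rep_nonzero (funext h)

variable [DecidableEq ι] {d : ι → ℕ}

theorem weight_apply [Fintype ι] (m : (Σ i, Fin (r i + 1)) →₀ ℕ) (i : ι) :
    Finsupp.weight (fun a : Σ i, Fin (r i + 1) => (Pi.single a.1 1 : ι → ℕ)) m i =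
      ∑ j, m ⟨i, j⟩ := by
  rw [Finsupp.weight_apply, Finsupp.sum_fintype _ _ (by simp), Finset.sum_apply, Fintype.sum_sigma,
    Finset.sum_eq_single i]
  · simp
  · intro b _ hb
    simp [Ne.symm hb]
  · simp

theorem eval_mul_of_mem_sections [Fintype ι] {f : CoxRing K r} (hf : f ∈ sections K r d)
    (c : ι → K) (v : (Σ i, Fin (r i + 1)) → K) :
    eval (fun a => c a.1 * v a) f = (∏ i, c i ^ d i) * eval v f := by
  rw [eval_eq', eval_eq', Finset.mul_sum]
  refine Finset.sum_congr rfl fun m hm => ?_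
  have hw := hf (mem_support_iff.1 hm)
  have : ∏ a : Σ i, Fin (r i + 1), c a.1 ^ m a = ∏ i, c i ^ d i := by
    rw [Fintype.prod_sigma]
    refine Finset.prod_congr rfl fun i _ => ?_
    dsimp only
    rw [Finset.prod_pow_eq_pow_sum, ← weight_apply, hw]
  simp only [mul_pow, Finset.prod_mul_distrib, this]
  ring

theorem pderiv_mem_sections {f : CoxRing K r} (hf : f ∈ sections K r d)
    (a : Σ i, Fin (r i + 1)) : pderiv a f ∈ sections K r (d - Pi.single a.1 1) := by
  -- If `d a.1 = 0` the subtraction truncates, but then the variable does not occur in `f` and the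
  -- derivative is zero.
  by_cases h : d a.1 = 0
  · have : pderiv a f = 0 := by
      apply pderiv_eq_zero_of_notMem_vars
      intro ha
      obtain ⟨m, hm, ham⟩ := (mem_vars_iff_mem_support a).1 ha
      have hw := congrFun (hf (mem_support_iff.1 hm)) a.1
      rw [h, Finsupp.weight_apply, Finsupp.sum, Finset.sum_apply, Finset.sum_eq_zero_iff] at hw
      have := hw a ham
      simp at this
      simp [this] at ham
    rw [this]
    exact Submodule.zero_mem _
  · refine IsWeightedHomogeneous.pderiv hf ?_
    ext i
    by_cases hi : i = a.1
    · subst hi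
      simp
      omega
    · simp [hi]

theorem euler_of_mem_sections [Fintype ι] {f : CoxRing K r} (hf : f ∈ sections K r d) (i : ι) :
    ∑ j, X ⟨i, j⟩ * pderiv ⟨i, j⟩ f = d i • f := by
  -- Keeping only the `i`-th entry of the multidegree gives weight 0 to the other blocks, so Euler's
  -- identity involves block `i` alone.
  have h : f.IsWeightedHomogeneous
      (fun a : Σ i, Fin (r i + 1) => (Pi.single a.1 1 : ι → ℕ) i) (d i) := by
    intro m hm
    rw [← hf hm, weight_apply, Finsupp.weight_apply, Finsupp.sum_fintype _ _ (by simp),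
      Fintype.sum_sigma, Finset.sum_eq_single i]
    · simp
    · intro b _ hb
      simp [Ne.symm hb]
    · simp
  rw [← h.sum_weight_X_mul_pderiv, Fintype.sum_sigma, Finset.sum_eq_single i]
  · simp
  · intro b _ hb
    simp [Ne.symm hb]
  · simp

/-- Rescaling the blocks multiplies a form by a nonzero constant. Vanishing can therefore be tested
on any homogeneous coordinates, not only on the chosen representatives. -/
theorem Represents.eval_eq_zero_iff [Fintype ι] {v : (Σ i, Fin (r i + 1)) → K}
    {x : MultiProj K r} (h : Represents v x) {f : CoxRing K r} (hf : f ∈ sections K r d) :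
    eval v f = 0 ↔ VanishesAt f x := by
  obtain ⟨c, hc, hx⟩ := h
  rw [VanishesAt, hx, eval_mul_of_mem_sections hf]
  simp [Finset.prod_eq_zero_iff, hc]

theorem Represents.doubly_iff [Fintype ι] {v : (Σ i, Fin (r i + 1)) → K}
    {x : MultiProj K r} (h : Represents v x) {f : CoxRing K r} (hf : f ∈ sections K r d) :
    (eval v f = 0 ∧ ∀ a, eval v (pderiv a f) = 0) ↔ VanishesDoublyAt f x := by
  simp only [VanishesDoublyAt, h.eval_eq_zero_iff hf,
    fun a => h.eval_eq_zero_iff (pderiv_mem_sections hf a)]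

/-- The exponents of the monomials of multidegree `d`, block by block. -/
noncomputable def weightEquiv (r d : ι → ℕ) [Fintype ι] :
    {m : (Σ i, Fin (r i + 1)) →₀ ℕ //
      Finsupp.weight (fun a : Σ i, Fin (r i + 1) => (Pi.single a.1 1 : ι → ℕ)) m = d} ≃
    ∀ i, {m : Fin (r i + 1) →₀ ℕ //
      m ∈ (Finset.univ : Finset (Fin (r i + 1))).finsuppAntidiag (d i)} where
  toFun m i := ⟨Finsupp.equivFunOnFinite.symm fun j => m.1 ⟨i, j⟩, by
    rw [Finset.mem_finsuppAntidiag]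
    refine ⟨?_, by simp⟩
    simp [← weight_apply, m.2]⟩
  invFun m := ⟨Finsupp.equivFunOnFinite.symm fun a => (m a.1).1 a.2, by
    ext i
    rw [weight_apply]
    exact (Finset.mem_finsuppAntidiag.1 (m i).2).1⟩
  left_inv m := by
    ext a
    simp
  right_inv m := by
    ext i j
    simp

theorem finite_weight (r d : ι → ℕ) [Fintype ι] :
    Finite {m : (Σ i, Fin (r i + 1)) →₀ ℕ |
      Finsupp.weight (fun a : Σ i, Fin (r i + 1) => (Pi.single a.1 1 : ι → ℕ)) m = d} :=
  Finite.of_equiv _ (weightEquiv r d).symm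

instance finite_sections [Fintype ι] : FiniteDimensional K (sections K r d) := by
  have := finite_weight r d
  rw [sections, weightedHomogeneousSubmodule_eq_finsupp_supported]
  exact Module.Finite.of_basis (basisRestrictSupport K _)

/-- The monomials form a basis; their exponents are chosen independently in each block and counted
by stars and bars. -/
theorem finrank_sections [Fintype ι] :
    Module.finrank K (sections K r d) = ∏ i, (r i + d i).choose (r i) := by
  rw [sections, weightedHomogeneousSubmodule_eq_finsupp_supported]
  refine (Module.finrank_eq_nat_card_basis (basisRestrictSupport K _)).trans ?_
  refine (Nat.card_congr (weightEquiv r d)).trans ?_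
  rw [Nat.card_pi]
  refine Finset.prod_congr rfl fun i _ => ?_
  rw [Nat.card_eq_fintype_card, Fintype.card_coe, Finset.card_finsuppAntidiag_nat_eq_choose]
  simp only [Finset.card_univ, Fintype.card_fin]
  rw [show r i + 1 + d i - 1 = r i + d i by omega, Nat.choose_symm_add]

end MultiProj

/-- Substituting weighted homogeneous polynomials into a weighted homogeneous polynomial. -/
theorem MvPolynomial.IsWeightedHomogeneous.aeval_of_weight {K σ σ' M M' : Type*} [CommSemiring K]
    [AddCommMonoid M] [AddCommMonoid M'] {w : σ → M} {w' : σ' → M'} (T : M →+ M')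
    {g : σ → MvPolynomial σ' K} (hg : ∀ a, (g a).IsWeightedHomogeneous w' (T (w a)))
    {f : MvPolynomial σ K} {n : M} (hf : f.IsWeightedHomogeneous w n) :
    (aeval g f).IsWeightedHomogeneous w' (T n) := by
  rw [aeval_def, eval₂_eq]
  refine IsWeightedHomogeneous.sum _ _ _ fun m hm => ?_
  refine IsWeightedHomogeneous.C_mul ?_ _
  have := IsWeightedHomogeneous.prod m.support (fun a => g a ^ m a) (fun a => m a • T (w a))
    fun a _ => (hg a).pow (m a)
  have hn := hf (mem_support_iff.1 hm)
  rw [Finsupp.weight_apply, Finsupp.sum] at hn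
  rw [← hn, map_sum]
  simpa only [map_nsmul] using this

/-! ### Double points as linear conditions, and semicontinuity. -/

namespace MultiProj

open MvPolynomial

section Jets

variable {K : Type*} [Field K] {ι : Type*} {r : ι → ℕ}

/-- A form (index `none`) and its partial derivatives. -/
noncomputable def jetPoly : Option (Σ i, Fin (r i + 1)) → CoxRing K r →ₗ[K] CoxRing K r
  | none => LinearMap.id
  | some a => (pderiv a).toLinearMap

/-- The value (index `none`) and the partial derivatives at `v`. -/
noncomputable def jet (v : (Σ i, Fin (r i + 1)) → K) (o : Option (Σ i, Fin (r i + 1))) :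
    CoxRing K r →ₗ[K] K :=
  (aeval v).toLinearMap ∘ₗ jetPoly o

theorem jet_apply (v : (Σ i, Fin (r i + 1)) → K) (o : Option (Σ i, Fin (r i + 1)))
    (f : CoxRing K r) : jet v o f = eval v (jetPoly o f) := by
  simp [jet, aeval_eq_eval]

theorem vanishesDoublyAt_iff_jet {f : CoxRing K r} {x : MultiProj K r} :
    VanishesDoublyAt f x ↔ ∀ o, jet x.coords o f = 0 := by
  simp only [jet_apply, Option.forall]
  rfl

variable {τ : Type*}

/-- Pull-back of a form along the projection to the `t`-th factor of a power. -/
noncomputable def pullback (t : τ) : CoxRing K r →ₐ[K] CoxRing K (fun b : τ × ι => r b.2) :=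
  aeval fun a => X ⟨(t, a.1), a.2⟩

theorem eval_pullback (t : τ) (f : CoxRing K r)
    (v : (Σ b : τ × ι, Fin (r b.2 + 1)) → K) :
    eval v (pullback t f) = eval (fun a => v ⟨(t, a.1), a.2⟩) f := by
  rw [pullback, ← coe_aeval_eq_eval, ← coe_aeval_eq_eval]
  simp only [RingHom.coe_coe]
  rw [← AlgHom.comp_apply, comp_aeval]
  simp

variable [DecidableEq ι] {d : ι → ℕ}

theorem jetPoly_mem_sections (o : Option (Σ i, Fin (r i + 1))) :
    ∃ d', ∀ f ∈ sections K r d, jetPoly o f ∈ sections K r d' := by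
  cases o with
  | none => exact ⟨d, fun f hf => hf⟩
  | some a => exact ⟨_, fun f hf => pderiv_mem_sections hf a⟩

theorem doublePointSystem_le_sections (z : τ → MultiProj K r) :
    doublePointSystem d z ≤ sections K r d := fun _ hf => hf.1

instance finite_doublePointSystem [Fintype ι] (z : τ → MultiProj K r) :
    FiniteDimensional K (doublePointSystem d z) :=
  Submodule.finiteDimensional_of_le (doublePointSystem_le_sections z)

theorem finrank_comap_doublePointSystem (z : τ → MultiProj K r) :
    Module.finrank K ((doublePointSystem d z).comap (sections K r d).subtype) = dimSystem d z :=
  (Submodule.comapSubtypeEquivOfLe (doublePointSystem_le_sections z)).finrank_eq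

/-- By Euler's relations, a double point is cut out by the value and all but one of the
derivatives in each block. -/
theorem vanishesDoublyAt_of_succAbove [Fintype ι] {f : CoxRing K r} (hf : f ∈ sections K r d)
    {x : MultiProj K r} (j : ∀ i, Fin (r i + 1)) (hj : ∀ i, x.coords ⟨i, j i⟩ ≠ 0)
    (h0 : eval x.coords f = 0)
    (h1 : ∀ i (k : Fin (r i)), eval x.coords (pderiv ⟨i, (j i).succAbove k⟩ f) = 0) :
    VanishesDoublyAt f x := by
  refine ⟨h0, ?_⟩
  rintro ⟨i, k⟩
  rw [VanishesAt]
  by_cases hk : k = j i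
  · subst hk
    have he := congrArg (eval x.coords) (euler_of_mem_sections hf i)
    rw [map_sum, Fin.sum_univ_succAbove _ (j i)] at he
    simp only [map_mul, eval_X, h1, mul_zero, Finset.sum_const_zero, add_zero, map_nsmul, h0,
      smul_zero, mul_eq_zero, hj, false_or] at he
    exact he
  · obtain ⟨k', rfl⟩ := Fin.exists_succAbove_eq hk
    exact h1 i k'

/-- A double point imposes at most `∑ r i + 1` conditions. -/
theorem finrank_sections_le [Fintype ι] [Fintype τ] (z : τ → MultiProj K r) :
    Module.finrank K (sections K r d) ≤
      dimSystem d z + (∑ i, r i + 1) * Fintype.card τ := by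
  choose j hj using fun t => coords_ne_zero (z t)
  -- The value and, in block `i`, the `r i` derivatives other than the one in the nonzero coordinate
  -- `j t i`: in total `∑ r i + 1` conditions per point.
  let o : ∀ t, Option (Σ i, Fin (r i)) → Option (Σ i, Fin (r i + 1)) := fun t =>
    Option.map fun a => ⟨a.1, (j t a.1).succAbove a.2⟩
  let L : sections K r d →ₗ[K] (τ × Option (Σ i, Fin (r i)) → K) :=
    LinearMap.pi fun b => jet (z b.1).coords (o b.1 b.2) ∘ₗ (sections K r d).subtype
  have hker : LinearMap.ker L ≤ (doublePointSystem d z).comap (sections K r d).subtype := by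
    intro f hf
    refine ⟨f.2, fun t => vanishesDoublyAt_of_succAbove f.2 (j t) (hj t) ?_ fun i k => ?_⟩
    · have := congrFun hf (t, none)
      rw [LinearMap.pi_apply, LinearMap.comp_apply, jet_apply] at this
      exact this
    · have := congrFun hf (t, some ⟨i, k⟩)
      rw [LinearMap.pi_apply, LinearMap.comp_apply, jet_apply] at this
      exact this
  have h1 := Submodule.finrank_mono hker
  rw [finrank_comap_doublePointSystem] at h1
  have h2 := LinearMap.finrank_range_add_finrank_ker L
  have h3 := Submodule.finrank_le (LinearMap.range L)
  rw [Module.finrank_fintype_fun_eq_card, Fintype.card_prod, Fintype.card_option,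
    Fintype.card_sigma] at h3
  simp only [Fintype.card_fin] at h3
  rw [mul_comm] at h3
  omega

theorem pullback_mem_sections [DecidableEq τ] (t : τ) {f : CoxRing K r}
    (hf : f ∈ sections K r d) :
    pullback t f ∈ sections K (fun b : τ × ι => r b.2) (fun b => if b.1 = t then d b.2 else 0) := by
  let T : (ι → ℕ) →+ (τ × ι → ℕ) :=
    { toFun := fun d b => if b.1 = t then d b.2 else 0
      map_zero' := by ext; simp
      map_add' := fun x y => by ext b; by_cases h : b.1 = t <;> simp [h] }
  refine IsWeightedHomogeneous.aeval_of_weight T (fun a => ?_) hf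
  have hT : T (Pi.single a.1 1) = Pi.single (t, a.1) 1 := by
    ext ⟨t', i⟩
    simp only [T, AddMonoidHom.coe_mk, ZeroHom.coe_mk, Pi.single_apply, Prod.mk.injEq]
    split_ifs <;> simp_all
  rw [hT]
  exact isWeightedHomogeneous_X K (fun a : Σ b : τ × ι, Fin (r b.2 + 1) => Pi.single a.1 1)
    ⟨(t, a.1), a.2⟩

/-- Every term of the Leibniz expansion takes one entry from each row, so a degree depending only on
the row suffices. Minors thus define Zariski open sets in the multihomogeneous sense. -/
theorem det_mem_sections {k : ℕ} (A : Matrix (Fin k) (Fin k) (CoxRing K r)) (δ : Fin k → ι → ℕ)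
    (hA : ∀ i j, A i j ∈ sections K r (δ i)) : A.det ∈ sections K r (∑ i, δ i) := by
  rw [Matrix.det_apply]
  refine Submodule.sum_mem _ fun σ _ => ?_
  rw [Units.smul_def, ← Int.cast_smul_eq_zsmul K]
  refine Submodule.smul_mem _ _ ?_
  rw [← Equiv.sum_comp σ δ]
  exact IsWeightedHomogeneous.prod _ _ _ fun i _ => hA (σ i) i

/-- Upper semicontinuity of the dimension of a linear system with assigned double points. -/
theorem exists_form_dimSystem_le [Fintype ι] [DecidableEq τ] (z₀ : τ → MultiProj K r) :
    ∃ F : CoxRing K (fun b : τ × ι => r b.2), (∃ δ, F ∈ sections K _ δ) ∧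
      ¬ VanishesAt F (ofTuple z₀) ∧
      ∀ z : τ → MultiProj K r, ¬ VanishesAt F (ofTuple z) → dimSystem d z ≤ dimSystem d z₀ := by
  let φ (z : τ → MultiProj K r) (c : τ × Option (Σ i, Fin (r i + 1))) :
      Module.Dual K (sections K r d) := jet (z c.1).coords c.2 ∘ₗ (sections K r d).subtype
  have hle : dimSystem d z₀ ≤ Module.finrank K (sections K r d) :=
    Submodule.finrank_mono (doublePointSystem_le_sections z₀)
  obtain ⟨c, f, hdet⟩ := Module.Dual.exists_det_ne_zero (φ z₀)
    ((doublePointSystem d z₀).comap (sections K r d).subtype)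
    (fun x hx => ⟨x.2, fun t => vanishesDoublyAt_iff_jet.2 fun o => hx (t, o)⟩)
    (Module.finrank K (sections K r d) - dimSystem d z₀)
    (by rw [finrank_comap_doublePointSystem]; omega)
  -- The minor found at `z₀` is the value of a determinant of forms on the power; where that form is
  -- nonzero, the codimension is at least the one at `z₀`.
  choose δ hδ using fun i => jetPoly_mem_sections (K := K) (d := d) (c i).2
  let A : Matrix (Fin _) (Fin _) (CoxRing K (fun b : τ × ι => r b.2)) :=
    Matrix.of fun i j => pullback (c i).1 (jetPoly (c i).2 (f j : CoxRing K r))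
  have hA (z : τ → MultiProj K r) : eval (ofTuple z).coords A.det =
      (Matrix.of fun i j => φ z (c i) (f j)).det := by
    rw [RingHom.map_det]
    congr 1
    ext i j
    simp only [A, φ, RingHom.mapMatrix_apply, Matrix.map_apply, Matrix.of_apply, eval_pullback,
      LinearMap.comp_apply, jet_apply]
    rfl
  refine ⟨A.det, ⟨_, det_mem_sections A _ fun i j =>
    pullback_mem_sections (c i).1 (hδ i _ (f j).2)⟩, ?_, fun z hz => ?_⟩
  · rwa [VanishesAt, hA]
  · rw [VanishesAt, hA] at hz
    have := Module.Dual.finrank_add_le_of_det_ne_zero (fun i => φ z (c i)) f hz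
      ((doublePointSystem d z).comap (sections K r d).subtype)
      (fun x hx i => vanishesDoublyAt_iff_jet.1 (hx.2 (c i).1) (c i).2)
    rw [finrank_comap_doublePointSystem] at this
    omega

end Jets

end MultiProj

/-! ### Restriction to a divisor of type `(0, …, 0, 1)`. -/

namespace MultiProj

open MvPolynomial

variable {K : Type*} [Field K] {ι : Type*} {r : ι → ℕ}

section Divisor

/-- The linear form on the factor `ℙ^1` with coefficients `α`. -/
noncomputable def lastLinearForm (r : ι → ℕ) (α : Fin 2 → K) : CoxRing K (adjoin r 1) :=
  C (α 0) * X ⟨none, (0 : Fin 2)⟩ + C (α 1) * X ⟨none, (1 : Fin 2)⟩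

/-- Coordinates of the zero on `ℙ^1` of the linear form with coefficients `α`. -/
def linearRoot (α : Fin 2 → K) : Fin 2 → K := ![α 1, -α 0]

theorem linearRoot_ne_zero {α : Fin 2 → K} (hα : α ≠ 0) : ∃ k, linearRoot α k ≠ 0 := by
  by_contra! h
  have h0 := h 0
  have h1 := h 1
  simp only [linearRoot, Matrix.cons_val_zero, Matrix.cons_val_one, neg_eq_zero] at h0 h1
  apply hα
  ext k
  fin_cases k
  · exact h1
  · exact h0

/-- Adjoin the last block of coordinates `c` to `v`. -/
def extendVec (c : Fin 2 → K) (v : (Σ i, Fin (r i + 1)) → K) :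
    (Σ o, Fin (adjoin r 1 o + 1)) → K
  | ⟨none, k⟩ => c k
  | ⟨some i, j⟩ => v ⟨i, j⟩

/-- The images of the coordinates under restriction to `∏ ℙ^{r i} × {c}`. -/
noncomputable def restrictVar (r : ι → ℕ) (c : Fin 2 → K) :
    (Σ o, Fin (adjoin r 1 o + 1)) → CoxRing K r
  | ⟨none, k⟩ => C (c k)
  | ⟨some i, j⟩ => X ⟨i, j⟩

/-- Restriction of forms to `∏ ℙ^{r i} × {c}`. -/
noncomputable def restrict (c : Fin 2 → K) : CoxRing K (adjoin r 1) →ₐ[K] CoxRing K r :=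
  aeval (restrictVar r c)

theorem eval_restrict (c : Fin 2 → K) (f : CoxRing K (adjoin r 1))
    (v : (Σ i, Fin (r i + 1)) → K) : eval v (restrict c f) = eval (extendVec c v) f := by
  rw [restrict, ← coe_aeval_eq_eval, ← coe_aeval_eq_eval]
  simp only [RingHom.coe_coe]
  rw [← AlgHom.comp_apply, comp_aeval]
  congr 2
  ext ⟨o, k⟩
  cases o <;> simp [restrictVar, extendVec]

/-- Restriction substitutes constants for the last block only, so it commutes with derivatives along
`Y`. -/
theorem pderiv_restrict (c : Fin 2 → K) (f : CoxRing K (adjoin r 1)) (i : ι)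
    (j : Fin (r i + 1)) :
    pderiv ⟨i, j⟩ (restrict c f) =
      restrict c (pderiv (⟨some i, j⟩ : Σ o, Fin (adjoin r 1 o + 1)) f) := by
  classical
  induction f using MvPolynomial.induction_on with
  | C a => simp [restrict]
  | add p q hp hq => simp only [map_add, hp, hq]
  | mul_X p a hp =>
    simp only [map_mul, Derivation.leibniz, hp, smul_eq_mul, map_add]
    congr 1
    congr 1
    obtain ⟨o, k⟩ := a
    cases o with
    | none =>
      have h : (⟨none, k⟩ : Σ o, Fin (adjoin r 1 o + 1)) ≠ ⟨some i, j⟩ := by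
        intro h; cases h
      simp [restrict, restrictVar, pderiv_X, h]
    | some i' =>
      simp only [restrict, aeval_X, restrictVar, pderiv_X, Pi.single_apply]
      by_cases h : (⟨i', k⟩ : Σ i, Fin (r i + 1)) = ⟨i, j⟩
      · have h' : (⟨some i', k⟩ : Σ o, Fin (adjoin r 1 o + 1)) = ⟨some i, j⟩ := by
          cases h; rfl
        rw [if_pos h, if_pos h', map_one]
      · have h' : (⟨some i', k⟩ : Σ o, Fin (adjoin r 1 o + 1)) ≠ ⟨some i, j⟩ := by
          intro h'; apply h; cases h'; rfl
        rw [if_neg h, if_neg h', map_zero]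

theorem eval_lastLinearForm (α : Fin 2 → K) (v : (Σ o, Fin (adjoin r 1 o + 1)) → K) :
    eval v (lastLinearForm r α) =
      α 0 * v ⟨none, (0 : Fin 2)⟩ + α 1 * v ⟨none, (1 : Fin 2)⟩ := by
  simp [lastLinearForm]

theorem eval_extendVec_lastLinearForm (α : Fin 2 → K) (v : (Σ i, Fin (r i + 1)) → K) :
    eval (extendVec (linearRoot α) v) (lastLinearForm r α) = 0 := by
  simp [eval_lastLinearForm, extendVec, linearRoot]
  ring

/-- This is the identification of `D` with `Y`: the last block of a point of `D` is proportional to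
the root of the linear form. -/
theorem represents_of_mem_zeroDivisor {α : Fin 2 → K} (hα : α ≠ 0)
    {x : MultiProj K (adjoin r 1)} (hx : x ∈ zeroDivisor (lastLinearForm r α)) :
    Represents (extendVec (linearRoot α) (forgetLast x).coords) x := by
  have hx' : α 0 * x.coords ⟨none, (0 : Fin 2)⟩ + α 1 * x.coords ⟨none, (1 : Fin 2)⟩ = 0 := by
    rw [← eval_lastLinearForm]; exact hx
  have h : ∃ c : K, ∀ k : Fin 2, x.coords ⟨none, k⟩ = c * linearRoot α k := by
    by_cases h1 : α 1 = 0
    · have h0 : α 0 ≠ 0 := by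
        intro h0
        apply hα
        ext k
        fin_cases k
        · exact h0
        · exact h1
      refine ⟨- x.coords ⟨none, (1 : Fin 2)⟩ / α 0, ?_⟩
      intro k
      fin_cases k
      · simp [linearRoot, h1]
        simpa [h1, h0] using hx'
      · simp [linearRoot]
        field_simp
    · refine ⟨x.coords ⟨none, (0 : Fin 2)⟩ / α 1, ?_⟩
      intro k
      fin_cases k
      · simp [linearRoot]
        field_simp
      · simp [linearRoot]
        field_simp
        linear_combination hx'
  obtain ⟨c, hc⟩ := h
  have hcoords : x.coords = fun a => (a.1.elim c fun _ => 1) *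
      extendVec (linearRoot α) (forgetLast x).coords a := by
    ext ⟨o, k⟩
    cases o with
    | none => exact hc k
    | some i => exact (one_mul _).symm
  refine ⟨fun o => o.elim c fun _ => 1, fun o => ?_, hcoords⟩
  cases o with
  | none =>
    obtain ⟨k, hk⟩ := coords_ne_zero x none
    intro h0
    exact hk ((hc k).trans (by rw [show c = 0 from h0, zero_mul]))
  | some i => exact one_ne_zero

variable [DecidableEq ι] {d : ι → ℕ}

theorem restrict_mem_sections (c : Fin 2 → K) {e : ℕ} {f : CoxRing K (adjoin r 1)}
    (hf : f ∈ sections K (adjoin r 1) (adjoin d e)) : restrict c f ∈ sections K r d := by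
  let T : (Option ι → ℕ) →+ (ι → ℕ) :=
    { toFun := fun d i => d (some i)
      map_zero' := by ext; simp
      map_add' := fun x y => by ext b; simp }
  refine IsWeightedHomogeneous.aeval_of_weight T ?_ hf
  rintro ⟨o, k⟩
  cases o with
  | none =>
    have : T (Pi.single none 1) = 0 := by ext i; simp [T]
    rw [this]
    exact isWeightedHomogeneous_C _ _
  | some i =>
    have : T (Pi.single (some i) 1) = Pi.single i 1 := by
      ext i'; simp [T, Pi.single_apply]
    rw [this]
    exact isWeightedHomogeneous_X K (fun a : Σ i, Fin (r i + 1) => Pi.single a.1 1) ⟨i, k⟩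

theorem lastLinearForm_mem_sections (α : Fin 2 → K) :
    lastLinearForm r α ∈ sections K (adjoin r 1) (adjoin (fun _ => 0) 1) := by
  have h : (adjoin (fun _ => 0) 1 : Option ι → ℕ) = Pi.single none 1 := by
    ext o; cases o <;> simp [adjoin]
  rw [h]
  exact ((isWeightedHomogeneous_X K
      (fun a : Σ o, Fin (adjoin r 1 o + 1) => Pi.single a.1 1) ⟨none, (0 : Fin 2)⟩).C_mul _).add
    ((isWeightedHomogeneous_X K
      (fun a : Σ o, Fin (adjoin r 1 o + 1) => Pi.single a.1 1) ⟨none, (1 : Fin 2)⟩).C_mul _)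

theorem exists_eq_C_of_mem_sections_zero [Fintype ι] {f : CoxRing K r}
    (hf : f ∈ sections K r 0) : ∃ a, f = C a := by
  refine ⟨coeff 0 f, ?_⟩
  ext m
  rw [coeff_C]
  split_ifs with h
  · rw [h]
  · by_contra hm
    apply h
    have hw := hf hm
    ext ⟨i, j⟩
    have := congrFun hw i
    rw [weight_apply, Pi.zero_apply, Finset.sum_eq_zero_iff] at this
    exact (this j (Finset.mem_univ j)).symm

/-- Forms of type `(0, …, 0, 1)` are linear forms on the factor `ℙ^1`. -/
theorem exists_eq_lastLinearForm [Fintype ι] {s : CoxRing K (adjoin r 1)}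
    (hs : s ∈ sections K (adjoin r 1) (adjoin (fun _ => 0) 1)) :
    ∃ α, s = lastLinearForm r α := by
  -- The derivatives along `ℙ^1` have multidegree 0, hence are constants; Euler's identity recovers
  -- `s` from them.
  have h (k : Fin 2) : ∃ a, pderiv (⟨none, k⟩ : Σ o, Fin (adjoin r 1 o + 1)) s = C a := by
    apply exists_eq_C_of_mem_sections_zero
    have h0 : (adjoin (fun _ => 0) 1 - Pi.single none 1 : Option ι → ℕ) = 0 := by
      ext o; cases o <;> simp [adjoin]
    rw [← h0]
    exact pderiv_mem_sections hs ⟨none, k⟩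
  choose α hα using h
  refine ⟨α, ?_⟩
  have he : ∑ j : Fin 2, X ⟨none, j⟩ * pderiv (⟨none, j⟩ : Σ o, Fin (adjoin r 1 o + 1)) s =
    (1 : ℕ) • s := euler_of_mem_sections hs none
  rw [Fin.sum_univ_two, one_smul, hα, hα] at he
  rw [← he, lastLinearForm]
  ring

/-- Homogeneous factors of forms can be cancelled inside the multigrading. -/
theorem exists_mem_sections_of_dvd {s f : CoxRing K r} {d₁ d₂ : ι → ℕ}
    (hs : s ∈ sections K r d₁) (hf : f ∈ sections K r (d₁ + d₂)) (h : s ∣ f) :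
    ∃ g ∈ sections K r d₂, f = s * g := by
  classical
  obtain ⟨g, rfl⟩ := h
  let _ : GradedAlgebra (sections K r) := weightedGradedAlgebra K
    (fun a : Σ i, Fin (r i + 1) => (Pi.single a.1 1 : ι → ℕ))
  -- The cofactor need not be homogeneous a priori; its component of degree `d₂` already gives `f`.
  have h1 := DirectSum.coe_decompose_mul_add_of_left_mem
    (sections K r) (j := d₂) (b := g) hs
  rw [DirectSum.decompose_of_mem_same _ hf] at h1
  exact ⟨_, SetLike.coe_mem _, h1⟩

/-- A form that restricts to zero on the divisor is divisible by its equation. -/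
theorem lastLinearForm_dvd [Fintype ι] [Infinite K] {α : Fin 2 → K} (hα : α ≠ 0) {e : ℕ}
    {f : CoxRing K (adjoin r 1)} (hf : f ∈ sections K (adjoin r 1) (adjoin d e))
    (h0 : restrict (linearRoot α) f = 0) : lastLinearForm r α ∣ f := by
  obtain ⟨k₁, hk₁⟩ := linearRoot_ne_zero hα
  -- The substitution `ψ` moves the last block onto the line spanned by the root. It kills `f`, by
  -- homogeneity and `h0`, and it is the identity modulo the equation of `D`; hence `f` is zero
  -- modulo that equation.
  let ψ : (Σ o, Fin (adjoin r 1 o + 1)) → CoxRing K (adjoin r 1)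
    | ⟨none, k⟩ => C (linearRoot α k / linearRoot α k₁) * X ⟨none, k₁⟩
    | ⟨some i, j⟩ => X ⟨some i, j⟩
  have hψ : aeval ψ f = 0 := by
    refine MvPolynomial.funext fun v => ?_
    rw [map_zero, ← coe_aeval_eq_eval]
    simp only [RingHom.coe_coe]
    rw [← AlgHom.comp_apply, comp_aeval]
    let c : Option ι → K := fun o => o.elim (v ⟨none, k₁⟩ / linearRoot α k₁) fun _ => 1
    let u : (Σ i, Fin (r i + 1)) → K := fun a => v ⟨some a.1, a.2⟩
    have hv : (fun a => (aeval v) (ψ a)) = fun a => c a.1 * extendVec (linearRoot α) u a := by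
      ext ⟨o, k⟩
      cases o with
      | none =>
        simp only [ψ, c, extendVec, map_mul, aeval_C, aeval_X, Option.elim]
        simp only [Algebra.algebraMap_self, RingHom.id_apply]
        ring
      | some i => simp [ψ, c, extendVec, u]
    rw [hv, ← RingHom.coe_coe, coe_aeval_eq_eval, eval_mul_of_mem_sections hf, ← eval_restrict, h0]
    simp
  have hdvd (k k' : Fin 2) : lastLinearForm r α ∣ C (linearRoot α k) * X ⟨none, k'⟩ -
      C (linearRoot α k') * X ⟨none, k⟩ := by
    fin_cases k <;> fin_cases k'
    · simp
    · exact ⟨1, by simp [linearRoot, lastLinearForm]; ring⟩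
    · exact ⟨-1, by simp [linearRoot, lastLinearForm]; ring⟩
    · simp
  have hmk : (Ideal.Quotient.mkₐ K (Ideal.span {lastLinearForm r α})).comp (aeval ψ) =
      Ideal.Quotient.mkₐ K (Ideal.span {lastLinearForm r α}) := by
    refine MvPolynomial.algHom_ext fun a => ?_
    rw [AlgHom.comp_apply, aeval_X, Ideal.Quotient.mkₐ_eq_mk, Ideal.Quotient.eq,
      Ideal.mem_span_singleton]
    obtain ⟨o, k⟩ := a
    cases o with
    | some i => simp [ψ]
    | none =>
      have h := (hdvd k k₁).mul_left (C (linearRoot α k₁)⁻¹)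
      rw [mul_sub, ← mul_assoc, ← mul_assoc, ← C_mul, ← C_mul, inv_mul_cancel₀ hk₁, C_1, one_mul,
        mul_comm (linearRoot α k₁)⁻¹, ← div_eq_mul_inv] at h
      exact h
  have := AlgHom.congr_fun hmk f
  rw [AlgHom.comp_apply, hψ, map_zero] at this
  rw [← Ideal.mem_span_singleton, ← Ideal.Quotient.eq_zero_iff_mem]
  exact this.symm

end Divisor

end MultiProj

/-! ### The residual system and Castelnuovo's inequality. -/

namespace MultiProj

open MvPolynomial

variable {K : Type*} [Field K] {ι : Type*} {r : ι → ℕ}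

section Castelnuovo

/-- If a product vanishes doubly at a point off the zeros of `s`, so does the other factor. -/
theorem VanishesDoublyAt.of_mul {s g : CoxRing K r} {x : MultiProj K r}
    (h : VanishesDoublyAt (s * g) x) (hs : ¬ VanishesAt s x) : VanishesDoublyAt g x := by
  have h0 : eval x.coords g = 0 := by
    have := h.1
    rw [VanishesAt, map_mul] at this
    exact (mul_eq_zero.1 this).resolve_left hs
  refine ⟨h0, fun a => ?_⟩
  have := h.2 a
  rw [VanishesAt, Derivation.leibniz, map_add, smul_eq_mul, smul_eq_mul, map_mul, map_mul, h0,
    zero_mul, add_zero] at this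
  exact (mul_eq_zero.1 this).resolve_left hs

theorem adjoin_succ (d : ι → ℕ) (e : ℕ) : adjoin d (e + 1) = adjoin (fun _ => 0) 1 + adjoin d e := by
  ext o
  cases o <;> simp [adjoin, add_comm]

variable [DecidableEq ι] {d : ι → ℕ} {τ τ' : Type*}

/-- The part of a linear system vanishing on the divisor is the residual system. -/
theorem exists_residual [Fintype ι] [Infinite K] {α : Fin 2 → K} (hα : α ≠ 0) {e : ℕ}
    {p : τ → MultiProj K (adjoin r 1)} (hp : ∀ t, ¬ VanishesAt (lastLinearForm r α) (p t))
    {f : CoxRing K (adjoin r 1)} (hf : f ∈ doublePointSystem (adjoin d (e + 1)) p)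
    (h0 : restrict (linearRoot α) f = 0) :
    ∃ g ∈ doublePointSystem (adjoin d e) p, f = lastLinearForm r α * g := by
  have hf1 := hf.1
  rw [adjoin_succ d] at hf1
  obtain ⟨g, hg, rfl⟩ := exists_mem_sections_of_dvd (lastLinearForm_mem_sections α) hf1
    (lastLinearForm_dvd hα hf.1 h0)
  exact ⟨g, ⟨hg, fun t => (hf.2 t).of_mul (hp t)⟩, rfl⟩

theorem VanishesDoublyAt.restrict [Fintype ι] {α : Fin 2 → K} (hα : α ≠ 0) {e : ℕ}
    {f : CoxRing K (adjoin r 1)} (hf : f ∈ sections K (adjoin r 1) (adjoin d e))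
    {x : MultiProj K (adjoin r 1)} (hx : x ∈ zeroDivisor (lastLinearForm r α))
    (h : VanishesDoublyAt f x) :
    VanishesDoublyAt (restrict (linearRoot α) f) (forgetLast x) := by
  obtain ⟨h1, h2⟩ := ((represents_of_mem_zeroDivisor hα hx).doubly_iff hf).2 h
  refine ⟨?_, ?_⟩
  · rw [VanishesAt, eval_restrict, h1]
  · rintro ⟨i, j⟩
    rw [VanishesAt, pderiv_restrict, eval_restrict, h2]

/-- At a point of `D` the `k`-th derivative of the product along `ℙ^1` equals `α k` times the value
of `g`, and some `α k` is nonzero. A double point on `D` thus leaves a simple point on the residual.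
-/
theorem VanishesDoublyAt.residual {α : Fin 2 → K} (hα : α ≠ 0)
    {g : CoxRing K (adjoin r 1)} {x : MultiProj K (adjoin r 1)}
    (hx : x ∈ zeroDivisor (lastLinearForm r α))
    (h : VanishesDoublyAt (lastLinearForm r α * g) x) : VanishesAt g x := by
  have hx' : eval x.coords (lastLinearForm r α) = 0 := hx
  have hk (k : Fin 2) : α k * eval x.coords g = 0 := by
    have := h.2 ⟨none, k⟩
    rw [VanishesAt, Derivation.leibniz, map_add, smul_eq_mul, smul_eq_mul, map_mul, map_mul, hx',
      zero_mul, zero_add] at this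
    have hd : eval x.coords
        (pderiv (⟨none, k⟩ : Σ o, Fin (adjoin r 1 o + 1)) (lastLinearForm r α)) = α k := by
      have h01 : (⟨none, (0 : Fin 2)⟩ : Σ o, Fin (adjoin r 1 o + 1)) ≠ ⟨none, (1 : Fin 2)⟩ := by
        intro h
        cases h
      fin_cases k <;> simp [lastLinearForm, pderiv_X, h01, h01.symm]
    rw [hd, mul_comm] at this
    exact this
  obtain ⟨k, hk'⟩ := Function.ne_iff.1 hα
  exact (mul_eq_zero.1 (hk k)).resolve_left hk'

/-- The forms vanishing at the points `q`. -/
def vanishingSubmodule (q : τ → MultiProj K r) : Submodule K (CoxRing K r) where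
  carrier := {g | ∀ j, VanishesAt g (q j)}
  add_mem' := fun hf hg j => by
    have h1 := hf j
    have h2 := hg j
    rw [VanishesAt] at *
    rw [map_add, h1, h2, add_zero]
  zero_mem' := fun j => by simp [VanishesAt]
  smul_mem' := fun c f hf j => by
    have h1 := hf j
    rw [VanishesAt] at *
    rw [smul_eval, h1, mul_zero]

/-- Castelnuovo's inequality for the divisor. -/
theorem dimSystem_sumElim_le [Fintype ι] [Infinite K] {α : Fin 2 → K} (hα : α ≠ 0) {e : ℕ}
    {p : τ → MultiProj K (adjoin r 1)} (hp : ∀ t, ¬ VanishesAt (lastLinearForm r α) (p t))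
    {q : τ' → MultiProj K (adjoin r 1)} (hq : ∀ j, q j ∈ zeroDivisor (lastLinearForm r α)) :
    dimSystem (adjoin d (e + 1)) (Sum.elim p q) ≤
      Module.finrank K ↥(doublePointSystem (adjoin d e) p ⊓ vanishingSubmodule q) +
        dimSystem d (fun j => forgetLast (q j)) := by
  let W := doublePointSystem (adjoin d (e + 1)) (Sum.elim p q)
  let L := (restrict (linearRoot α)).toLinearMap.domRestrict W
  have hrange : LinearMap.range L ≤ doublePointSystem d (fun j => forgetLast (q j)) := by
    rintro _ ⟨f, rfl⟩
    exact ⟨restrict_mem_sections _ f.2.1, fun j => (f.2.2 (Sum.inr j)).restrict hα f.2.1 (hq j)⟩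
  have hker : (LinearMap.ker L).map W.subtype ≤
      (doublePointSystem (adjoin d e) p ⊓ vanishingSubmodule q).map
        (LinearMap.mulLeft K (lastLinearForm r α)) := by
    rintro _ ⟨f, hf, rfl⟩
    obtain ⟨g, hg, hfg⟩ := exists_residual hα hp (f := f) (d := d) (e := e)
      ⟨f.2.1, fun t => f.2.2 (Sum.inl t)⟩ hf
    refine ⟨g, ⟨hg, fun j => ?_⟩, hfg.symm⟩
    have := f.2.2 (Sum.inr j)
    rw [hfg] at this
    exact this.residual hα (hq j)
  have : FiniteDimensional K ↥(doublePointSystem (adjoin d e) p ⊓ vanishingSubmodule q) :=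
    Submodule.finiteDimensional_of_le inf_le_left
  have h1 := LinearMap.finrank_range_add_finrank_ker L
  have h2 := Submodule.finrank_mono hrange
  have h3 := Submodule.finrank_mono hker
  have h4 := Submodule.finrank_map_le (LinearMap.mulLeft K (lastLinearForm r α))
    (doublePointSystem (adjoin d e) p ⊓ vanishingSubmodule q)
  rw [Submodule.finrank_map_subtype_eq] at h3
  change Module.finrank K W ≤ _ + Module.finrank K (doublePointSystem d _)
  omega

end Castelnuovo

/-! ### General tuples through polynomials in homogeneous coordinates. -/

section General

variable {τ : Type*}

/-- A tuple of vectors of homogeneous coordinates represents a point of the power. -/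
theorem represents_ofTuple {u : (Σ b : τ × ι, Fin (r b.2 + 1)) → K} {z : τ → MultiProj K r}
    (h : ∀ t, Represents (fun a => u ⟨(t, a.1), a.2⟩) (z t)) : Represents u (ofTuple z) := by
  choose c hc hz using h
  refine ⟨fun b => c b.1 b.2, fun b => hc _ _, ?_⟩
  ext ⟨⟨t, i⟩, j⟩
  exact congrFun (hz t) ⟨i, j⟩

/-- The tuple of points with given homogeneous coordinates. -/
noncomputable def tupleOfVec (v : (Σ b : τ × ι, Fin (r b.2 + 1)) → K) (hv : ∀ a, v a ≠ 0) (t : τ) :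
    MultiProj K r :=
  ofVec (fun a => v ⟨(t, a.1), a.2⟩) fun _ => ⟨0, hv _⟩

theorem represents_tupleOfVec (v : (Σ b : τ × ι, Fin (r b.2 + 1)) → K) (hv : ∀ a, v a ≠ 0) (t : τ) :
    Represents (fun a => v ⟨(t, a.1), a.2⟩) (tupleOfVec v hv t) :=
  represents_ofVec _ _

/-- The tuple of points of `∏ ℙ^{r i} × {c}` with given homogeneous coordinates. -/
noncomputable def divisorTuple {c : Fin 2 → K} (hc : ∃ k, c k ≠ 0)
    (v : (Σ b : τ × ι, Fin (r b.2 + 1)) → K) (hv : ∀ a, v a ≠ 0) (t : τ) :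
    MultiProj K (adjoin r 1) :=
  ofVec (extendVec c fun a => v ⟨(t, a.1), a.2⟩) fun o =>
    match o with
    | none => hc
    | some _ => ⟨0, hv _⟩

theorem represents_divisorTuple {c : Fin 2 → K} (hc : ∃ k, c k ≠ 0)
    (v : (Σ b : τ × ι, Fin (r b.2 + 1)) → K) (hv : ∀ a, v a ≠ 0) (t : τ) :
    Represents (extendVec c fun a => v ⟨(t, a.1), a.2⟩) (divisorTuple hc v hv t) :=
  represents_ofVec _ _

/-- The images of the coordinates under restriction of forms on a power of `∏ ℙ^{r i} × ℙ^1` to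
the power of `∏ ℙ^{r i} × {c}`. -/
noncomputable def restrictTupleVar (r : ι → ℕ) (c : Fin 2 → K) :
    (Σ b : τ × Option ι, Fin (adjoin r 1 b.2 + 1)) → CoxRing K (fun b : τ × ι => r b.2)
  | ⟨(_, none), k⟩ => C (c k)
  | ⟨(t, some i), j⟩ => X ⟨(t, i), j⟩

variable [DecidableEq ι]

/-- Each general condition becomes the nonvanishing of one nonzero polynomial, so several conditions
are met at once where the product is nonzero. Nonzero coordinates ensure that every block defines a
point. -/
theorem ForGeneralTuple.exists_polynomial [Fintype ι] [Fintype τ] [DecidableEq τ]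
    {P : (τ → MultiProj K r) → Prop} (h : ForGeneralTuple Set.univ P) :
    ∃ F : CoxRing K (fun b : τ × ι => r b.2), F ≠ 0 ∧
      ∀ v (hv : ∀ a, v a ≠ 0), eval v F ≠ 0 → P (tupleOfVec v hv) := by
  obtain ⟨U, ⟨A, hA, rfl⟩, ⟨z, -, F, hF, hFz⟩, hU⟩ := h
  obtain ⟨δ, hδ⟩ := hA F hF
  refine ⟨F, fun h0 => hFz (by simp [h0, VanishesAt]), fun v hv hFv => ?_⟩
  refine hU _ trivial ⟨F, hF, ?_⟩
  rwa [← (represents_ofTuple (represents_tupleOfVec v hv)).eval_eq_zero_iff hδ]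

theorem divisorTuple_mem_zeroDivisor [Fintype ι] {α : Fin 2 → K} (hα : α ≠ 0)
    (v : (Σ b : τ × ι, Fin (r b.2 + 1)) → K) (hv : ∀ a, v a ≠ 0) (t : τ) :
    divisorTuple (linearRoot_ne_zero hα) v hv t ∈ zeroDivisor (lastLinearForm r α) :=
  ((represents_divisorTuple (linearRoot_ne_zero hα) v hv t).eval_eq_zero_iff
    (lastLinearForm_mem_sections α)).1 (eval_extendVec_lastLinearForm α _)

theorem ForGeneralTuple.exists_polynomial_divisor [Fintype ι] [Fintype τ] [DecidableEq τ]
    {α : Fin 2 → K} (hα : α ≠ 0) {P : (τ → MultiProj K (adjoin r 1)) → Prop}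
    (h : ForGeneralTuple {q | ∀ j, q j ∈ zeroDivisor (lastLinearForm r α)} P) :
    ∃ F : CoxRing K (fun b : τ × ι => r b.2), F ≠ 0 ∧
      ∀ v (hv : ∀ a, v a ≠ 0), eval v F ≠ 0 → P (divisorTuple (linearRoot_ne_zero hα) v hv) := by
  obtain ⟨U, ⟨A, hA, rfl⟩, ⟨z, hz, F, hF, hFz⟩, hU⟩ := h
  obtain ⟨δ, hδ⟩ := hA F hF
  let ext (v : (Σ b : τ × ι, Fin (r b.2 + 1)) → K) :
      (Σ b : τ × Option ι, Fin (adjoin r 1 b.2 + 1)) → K :=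
    fun a => extendVec (linearRoot α) (fun a' => v ⟨(a.1.1, a'.1), a'.2⟩) ⟨a.1.2, a.2⟩
  have hext (v) : eval v (aeval (restrictTupleVar r (linearRoot α)) F) = eval (ext v) F := by
    rw [← coe_aeval_eq_eval, ← coe_aeval_eq_eval]
    simp only [RingHom.coe_coe]
    rw [← AlgHom.comp_apply, comp_aeval]
    congr 2
    ext ⟨⟨t, o⟩, k⟩
    cases o <;> simp [restrictTupleVar, extendVec, ext]
  refine ⟨aeval (restrictTupleVar r (linearRoot α)) F, fun h0 => hFz ?_, fun v hv hFv => ?_⟩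
  · let v₀ : (Σ b : τ × ι, Fin (r b.2 + 1)) → K := fun a => (forgetLast (z a.1.1)).coords ⟨a.1.2, a.2⟩
    rw [← (represents_ofTuple (u := ext v₀) fun t =>
      represents_of_mem_zeroDivisor hα (hz t)).eval_eq_zero_iff hδ, ← hext, h0, map_zero]
  · refine hU _ (divisorTuple_mem_zeroDivisor hα v hv) ⟨F, hF, ?_⟩
    rw [← (represents_ofTuple (u := ext v) fun t =>
      represents_divisorTuple (linearRoot_ne_zero hα) v hv t).eval_eq_zero_iff hδ, ← hext]
    exact hFv

/-- General points of the divisor impose independent conditions on a linear system whose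
restriction to the divisor is large enough. -/
theorem exists_polynomial_independent [Fintype ι] [Infinite K] {α : Fin 2 → K}
    (hα : α ≠ 0) {δ : Option ι → ℕ} {V : Submodule K (CoxRing K (adjoin r 1))}
    (hV : V ≤ sections K (adjoin r 1) δ) (h : ℕ)
    (hh : Module.finrank K ↥(V ⊓ LinearMap.ker (restrict (r := r) (linearRoot α)).toLinearMap) + h ≤
      Module.finrank K V) :
    ∃ F : CoxRing K (fun b : Fin h × ι => r b.2), F ≠ 0 ∧
      ∀ v (hv : ∀ a, v a ≠ 0), eval v F ≠ 0 → Module.finrank K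
        ↥(V ⊓ vanishingSubmodule (divisorTuple (linearRoot_ne_zero hα) v hv)) + h ≤
          Module.finrank K V := by
  have : FiniteDimensional K V := Submodule.finiteDimensional_of_le hV
  let φ (u : (Σ i, Fin (r i + 1)) → K) : Module.Dual K V :=
    (aeval u).toLinearMap ∘ₗ (restrict (linearRoot α)).toLinearMap ∘ₗ V.subtype
  have hφ (u) (g : V) : φ u g = eval u (restrict (linearRoot α) (g : CoxRing K (adjoin r 1))) := by
    simp [φ, aeval_eq_eval]
  have hcomap (W : Submodule K (CoxRing K (adjoin r 1))) :
      Module.finrank K ↥((V ⊓ W).comap V.subtype) = Module.finrank K ↥(V ⊓ W) :=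
    (Submodule.comapSubtypeEquivOfLe inf_le_left).finrank_eq
  -- Over an infinite field, a form killed by evaluation at all vectors over `D` restricts to zero,
  -- so these functionals have rank at least `h` on `V`.
  obtain ⟨c, f, hdet⟩ := Module.Dual.exists_det_ne_zero φ
    ((V ⊓ LinearMap.ker (restrict (r := r) (linearRoot α)).toLinearMap).comap V.subtype)
    (fun g hg => ⟨g.2, MvPolynomial.funext fun u => by
      rw [map_zero]; exact (hφ u g).symm.trans (hg u)⟩) h (by rwa [hcomap])
  -- Row `i` is evaluated at the `i`-th point, so the determinant is a polynomial in the whole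
  -- tuple; the vectors `c` show that it is nonzero.
  let A : Matrix (Fin h) (Fin h) (CoxRing K (fun b : Fin h × ι => r b.2)) :=
    Matrix.of fun i j => pullback i (restrict (linearRoot α) (f j : CoxRing K (adjoin r 1)))
  have hA (v) : eval v A.det =
      (Matrix.of fun i j => φ (fun a => v ⟨(i, a.1), a.2⟩) (f j)).det := by
    rw [RingHom.map_det]
    congr 1
    ext i j
    simp only [A, RingHom.mapMatrix_apply, Matrix.map_apply, Matrix.of_apply, eval_pullback, hφ]
  refine ⟨A.det, fun h0 => hdet ?_, fun v hv hFv => ?_⟩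
  · have := hA fun a => c a.1.1 ⟨a.1.2, a.2⟩
    rw [h0, map_zero] at this
    exact this.symm
  · rw [hA] at hFv
    have := Module.Dual.finrank_add_le_of_det_ne_zero _ f hFv
      ((V ⊓ vanishingSubmodule (divisorTuple (linearRoot_ne_zero hα) v hv)).comap V.subtype)
      (fun g hg i => by
        rw [hφ, eval_restrict, (represents_divisorTuple (linearRoot_ne_zero hα) v hv
          i).eval_eq_zero_iff (hV g.2)]
        exact hg.2 i)
    rwa [hcomap] at this

end General

end MultiProj

/-! ### The degeneration argument. -/

namespace MultiProj

open MvPolynomial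

variable {K : Type*} [Field K] {ι : Type*} {r : ι → ℕ} [DecidableEq ι]

/-- General points do not lie on the zero divisor of a nonzero form. -/
theorem exists_polynomial_not_vanishesAt [Fintype ι] [Infinite K] {τ : Type*} [Fintype τ]
    {δ : ι → ℕ} {s : CoxRing K r} (hs : s ∈ sections K r δ) (hs0 : s ≠ 0) :
    ∃ F : CoxRing K (fun b : τ × ι => r b.2), F ≠ 0 ∧
      ∀ v (hv : ∀ a, v a ≠ 0), eval v F ≠ 0 → ∀ t, ¬ VanishesAt s (tupleOfVec v hv t) := by
  obtain ⟨u, -, hu⟩ := exists_eval_ne_zero hs0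
  refine ⟨∏ t, pullback t s, fun h0 => ?_, fun v hv hF t => ?_⟩
  · have := congrArg (eval fun a => u ⟨a.1.2, a.2⟩) h0
    rw [map_prod, map_zero, Finset.prod_eq_zero_iff] at this
    obtain ⟨t, -, ht⟩ := this
    rw [eval_pullback] at ht
    exact hu ht
  · rw [map_prod, Finset.prod_ne_zero_iff] at hF
    have := hF t (Finset.mem_univ t)
    rwa [eval_pullback, ne_eq, (represents_tupleOfVec v hv t).eval_eq_zero_iff hs] at this

/-- If the residual and the trace systems of a system with `l` general double points and `h` double
points on a divisor of type `(0, …, 0, 1)` have the expected dimension, and the second residual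
system is small enough, then the system has the expected dimension. -/
theorem forGeneralTuple_dimSystem_eq [Fintype ι] [Infinite K] {d : ι → ℕ} (e h l : ℕ)
    (s : CoxRing K (adjoin r 1)) (hs : s ∈ sections K (adjoin r 1) (adjoin (fun _ => 0) 1))
    (hs0 : s ≠ 0)
    (residual : ForGeneralTuple Set.univ fun p : Fin l → MultiProj K (adjoin r 1) =>
      (dimSystem (adjoin d (e + 1)) p : ℤ) =
        (∏ i, ((r i + d i).choose (r i) : ℤ)) * (e + 2) - ((∑ i, (r i : ℤ)) + 2) * l)
    (trace : ForGeneralTuple {q | ∀ j, q j ∈ zeroDivisor s}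
      fun q : Fin h → MultiProj K (adjoin r 1) =>
        (dimSystem d (fun j => forgetLast (q j)) : ℤ) =
          (∏ i, ((r i + d i).choose (r i) : ℤ)) - ((∑ i, (r i : ℤ)) + 1) * h)
    (bound : ForGeneralTuple Set.univ fun p : Fin l → MultiProj K (adjoin r 1) =>
      (dimSystem (adjoin d e) p : ℤ) ≤
        (∏ i, ((r i + d i).choose (r i) : ℤ)) * (e + 2) - ((∑ i, (r i : ℤ)) + 2) * l - h) :
    ForGeneralTuple {z | ∀ j, z (Sum.inr j) ∈ zeroDivisor s}
      fun z : Fin l ⊕ Fin h → MultiProj K (adjoin r 1) =>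
        (dimSystem (adjoin d (e + 2)) z : ℤ) =
          (∏ i, ((r i + d i).choose (r i) : ℤ)) * (e + 3) -
            ((∑ i, (r i : ℤ)) + 2) * (l + h) := by
  obtain ⟨α, rfl⟩ := exists_eq_lastLinearForm hs
  have hα : α ≠ 0 := by
    rintro rfl
    exact hs0 (by simp [lastLinearForm])
  obtain ⟨F₁, hF₁, h₁⟩ := residual.exists_polynomial
  obtain ⟨F₂, hF₂, h₂⟩ := bound.exists_polynomial
  obtain ⟨F₃, hF₃, h₃⟩ := exists_polynomial_not_vanishesAt (τ := Fin l) hs hs0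
  -- A single tuple `p` satisfies both dimension assumptions and avoids `D`; it stays fixed while
  -- `q` is chosen.
  obtain ⟨v, hv, hFv⟩ := exists_eval_ne_zero (mul_ne_zero (mul_ne_zero hF₁ hF₂) hF₃)
  simp only [map_mul, ne_eq, mul_eq_zero, not_or] at hFv
  have hres := h₁ v hv hFv.1.1
  have hbound := h₂ v hv hFv.1.2
  have hp := h₃ v hv hFv.2
  generalize tupleOfVec v hv = p at hres hbound hp
  have hkernel : Module.finrank K ↥(doublePointSystem (adjoin d (e + 1)) p ⊓
      LinearMap.ker (restrict (r := r) (linearRoot α)).toLinearMap) ≤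
      dimSystem (adjoin d e) p := by
    refine (Submodule.finrank_mono (t := (doublePointSystem (adjoin d e) p).map
      (LinearMap.mulLeft K (lastLinearForm r α))) ?_).trans (Submodule.finrank_map_le _ _)
    rintro f ⟨hf, hf0⟩
    obtain ⟨g, hg, hfg⟩ := exists_residual hα hp hf hf0
    exact ⟨g, hg, hfg.symm⟩
  obtain ⟨G₁, hG₁, k₁⟩ := trace.exists_polynomial_divisor hα
  -- The right-hand side of `bound` is exactly the dimension of the residual system minus `h`.
  obtain ⟨G₂, hG₂, k₂⟩ := exists_polynomial_independent hα
    (doublePointSystem_le_sections (d := adjoin d (e + 1)) p) h (by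
      change _ ≤ dimSystem (adjoin d (e + 1)) p
      zify at hkernel ⊢
      linarith)
  obtain ⟨u, hu, hGu⟩ := exists_eval_ne_zero (mul_ne_zero hG₁ hG₂)
  simp only [map_mul, ne_eq, mul_eq_zero, not_or] at hGu
  have htrace := k₁ u hu hGu.1
  have hindep := k₂ u hu hGu.2
  have hq : ∀ j, divisorTuple (linearRoot_ne_zero hα) u hu j ∈
      zeroDivisor (lastLinearForm r α) := fun j =>
    divisorTuple_mem_zeroDivisor hα u hu j
  generalize divisorTuple (linearRoot_ne_zero hα) u hu = q at htrace hindep hq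
  have hupper := dimSystem_sumElim_le (d := d) (e := e + 1) hα hp hq
  obtain ⟨F, hF, hF0, hFle⟩ := exists_form_dimSystem_le (d := adjoin d (e + 2)) (Sum.elim p q)
  refine ⟨{x | ¬ VanishesAt F x}, ⟨{F}, by simpa using hF, by simp⟩,
    ⟨Sum.elim p q, hq, hF0⟩, fun z _ hz => ?_⟩
  have hle := hFle z hz
  -- The lower bound for an arbitrary tuple: the factor `ℙ^1` contributes `e + 3` to the number of
  -- forms and 1 to the dimension, so each double point costs at most `R + 2`.
  have hge := finrank_sections_le (d := adjoin d (e + 2)) z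
  rw [finrank_sections, Fintype.prod_option, Fintype.sum_option] at hge
  simp only [adjoin, Fintype.card_sum, Fintype.card_fin, Nat.choose_one_right] at hge
  change _ ≤ dimSystem (adjoin d (e + 1)) p at hindep
  zify at hle hge hupper hindep
  push_cast at *
  apply le_antisymm <;> linarith

end MultiProj

theorem proposition6 {K : Type*} [Field K] [IsAlgClosed K] [CharZero K]
    (n : ℕ) (hn : 1 ≤ n) (r d : Fin n → ℕ) (hr : ∀ i, 1 ≤ r i) (hd : ∀ i, 1 ≤ d i)
    -- `e` is the degree on the last factor `ℙ^1`
    (e : ℕ) (he : 2 ≤ e) (h l : ℕ)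
    (hh : h ≤ (∏ i, (r i + d i).choose (r i)) / ((∑ i, r i) + 1))
    (hl : l + (∏ i, (r i + d i).choose (r i)) / ((∑ i, r i) + 1) ≤
      ((∏ i, (r i + d i).choose (r i)) * (e + 1)) / ((∑ i, r i) + 2))
    -- the divisor `D` of type `(0, …, 0, 1)` is the zero divisor of `s`
    (s : CoxRing K (MultiProj.adjoin r 1))
    (hs : s ∈ MultiProj.sections K (MultiProj.adjoin r 1) (MultiProj.adjoin (fun _ => 0) 1))
    (hs0 : s ≠ 0)
    (residual : MultiProj.ForGeneralTuple Set.univ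
      fun p : Fin l → MultiProj K (MultiProj.adjoin r 1) =>
        (MultiProj.dimSystem (MultiProj.adjoin d (e - 1)) p : ℤ) =
          (∏ i, ((r i + d i).choose (r i) : ℤ)) * e - ((∑ i, (r i : ℤ)) + 2) * l)
    (trace : MultiProj.ForGeneralTuple {q | ∀ j, q j ∈ MultiProj.zeroDivisor s}
      fun q : Fin h → MultiProj K (MultiProj.adjoin r 1) =>
        (MultiProj.dimSystem d (fun j => MultiProj.forgetLast (q j)) : ℤ) =
          (∏ i, ((r i + d i).choose (r i) : ℤ)) - ((∑ i, (r i : ℤ)) + 1) * h)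
    (bound : MultiProj.ForGeneralTuple Set.univ
      fun p : Fin l → MultiProj K (MultiProj.adjoin r 1) =>
        (MultiProj.dimSystem (MultiProj.adjoin d (e - 2)) p : ℤ) ≤
          (∏ i, ((r i + d i).choose (r i) : ℤ)) * e - ((∑ i, (r i : ℤ)) + 2) * l - h) :
    -- `z` consists of `l` points of `∏ ℙ^{r i} × ℙ^1` and `h` points of `D`
    MultiProj.ForGeneralTuple {z | ∀ j, z (Sum.inr j) ∈ MultiProj.zeroDivisor s}
      fun z : Fin l ⊕ Fin h → MultiProj K (MultiProj.adjoin r 1) =>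
        (MultiProj.dimSystem (MultiProj.adjoin d e) z : ℤ) =
          (∏ i, ((r i + d i).choose (r i) : ℤ)) * (e + 1) - ((∑ i, (r i : ℤ)) + 2) * (l + h) := by
  -- Since `2 ≤ e`, the natural-number subtractions `e - 1` and `e - 2` do not truncate.
  obtain ⟨e, rfl⟩ : ∃ e', e = e' + 2 := ⟨e - 2, by omega⟩
  simp only [Nat.add_sub_cancel, show e + 2 - 1 = e + 1 from rfl, Nat.cast_add, Nat.cast_ofNat]
    at residual bound
  have key := MultiProj.forGeneralTuple_dimSystem_eq e h l s hs hs0 residual trace bound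
  simpa only [Nat.cast_add, Nat.cast_ofNat, add_assoc, show (2 : ℤ) + 1 = 3 from rfl] using key
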